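/- **Theorem.** Let $n\ge 1$ be an integer and let $\alpha>0$ be a real number. In the network creation game with player set $V=\{1,\dots,n\}$ and edge price $\alpha$, a strategy $s_i$ of player $i$ is a set of edges $\{i,j\}$, $j\in V\setminus\{i\}$, that $i$ buys. A strategy vector $s=(s_1,\dots,s_n)$ creates the undirected simple graph $G_s=(V,E_s)$ with $E_s=s_1\cup\dots\cup s_n$, and the cost of player $i$ is $$c_i(s)=\alpha\cdot|s_i|+\sum_{j=1}^{n}\mathrm{dist}_{G_s}(i,j),$$ where $\mathrm{dist}_{G_s}(i,j)=\infty$ if $i$ and $j$ lie in different components of $G_s$. The vector $s$ is a Nash equilibrium if no player $i$ can strictly decrease $c_i$ by replacing $s_i$ with another strategy $s_i'$ while all other players keep their strategies. A graph $G$ on $V$ is a Nash equilibrium graph if $G=G_s$ for some Nash equilibrium $s$. If $\alpha\ge 65n$, then every Nash equilibrium graph is a tree. -/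

import Mathlib

open scoped NNReal ENNReal

namespace NetworkCreation

variable {V : Type*} [Fintype V] [DecidableEq V]

/-- A strategy of player `i` is the set of edges adjacent to `i` that `i` buys. The edge `{i, j}`
is recorded by its other endpoint `j`, which is a player different from `i`. -/
abbrev Strategy (i : V) : Type _ := {S : Finset V // i ∉ S}

variable (V) in
/-- A strategy vector `s`: one strategy for every player. -/
abbrev Profile : Type _ := (i : V) → Strategy i

/-- The undirected graph `G_s` created by the strategy vector `s`: its edges are the pairs `{i, j}`
such that `i` buys the edge to `j` or `j` buys the edge to `i`. -/
def graph (s : Profile V) : SimpleGraph V where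
  Adj i j := j ∈ (s i).1 ∨ i ∈ (s j).1
  symm := ⟨fun _ _ h => h.symm⟩
  loopless := ⟨fun i h => h.elim (s i).2 (s i).2⟩

/-- The cost `α * |s_i| + ∑ j, dist (i, j)` of player `i`, where `dist` is the distance in `G_s`
and is infinite between vertices in different components. -/
noncomputable def cost (α : ℝ≥0) (s : Profile V) (i : V) : ℝ≥0∞ :=
  (α : ℝ≥0∞) * ((s i).1.card : ℝ≥0∞) + ∑ j : V, ((graph s).edist i j : ℝ≥0∞)

/-- `s` is a Nash equilibrium: no player `i` can strictly decrease its own cost by replacing its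
strategy with any other strategy `t`, all the other players keeping theirs. -/
def IsNashEquilibrium (α : ℝ≥0) (s : Profile V) : Prop :=
  ∀ (i : V) (t : Strategy i), cost α s i ≤ cost α (Function.update s i t) i

/-- `G` is a Nash equilibrium graph for the edge price `α`: it is created by some strategy vector
that is a Nash equilibrium. -/
def IsNashGraph (α : ℝ≥0) (G : SimpleGraph V) : Prop :=
  ∃ s : Profile V, IsNashEquilibrium α s ∧ graph s = G

end NetworkCreation

/-! ### Distances and single-player deviations -/

namespace NetworkCreation

variable {V : Type*}

/-! An equilibrium graph is connected. Take a root `r` of least distance sum and a breadth-first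
tree; a chord is a non-tree edge. All contradictions come from deviations that save `α ≥ 65 n`, or
nothing, on edges and are then charged in distance.

A chord bought by `u` ends outside the subtrees of the first 21 ancestors of `u`, since otherwise
selling it costs at most `43 n` (`BuysChord.not_isBelow`). Hence a vertex buys at most one loose
edge: with two, it would sell both and buy an edge to `r` (`eq_of_isLoose`). Consequently the tree
edges just above a chord owner are bought downwards, and the chains of 21 ancestors of different
owners are disjoint (`BuysChord.mem_iterate`, `BuysChord.eq_of_iterate_eq`).

If ten consecutive chain vertices had only bridges besides their two chain edges, swapping an edge
for the one a step further would force subtree sizes to double along the chain. Then almost all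
vertices get closer as one climbs, and the distance sum would fall below that of `r`
(`BuysChord.exists_not_isBridge`). So every chord owner accounts for two private vertices of degree
at least 3 in the graph `H` of non-bridge edges.

If `H` had an edge, let `W` be its non-isolated vertices and `U` the chord owners. All degrees on
`W` are at least 2, so the degree sum is at least `2|W| + 2|U|`; but `H` has fewer than `|W| + |U|`
edges. Hence every edge is a bridge. -/

theorem exists_adj_dist_add_one {G : SimpleGraph V} (hG : G.Connected) {a b : V} (h : a ≠ b) :
    ∃ z, G.Adj a z ∧ G.dist z b + 1 = G.dist a b := by
  obtain ⟨w, hw⟩ := hG.exists_walk_length_eq_dist a b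
  cases w with
  | nil => exact absurd rfl h
  | @cons _ z _ haz q =>
    refine ⟨z, haz, le_antisymm ?_ ?_⟩
    · have := SimpleGraph.dist_le q
      simp only [SimpleGraph.Walk.length_cons] at hw
      omega
    · have h1 : G.dist a b ≤ G.dist a z + G.dist z b := hG.dist_triangle
      have h2 : G.dist a z = 1 := SimpleGraph.dist_eq_one_iff_adj.2 haz
      omega

theorem dist_le_dist_add_one {G : SimpleGraph V} (hG : G.Connected) {a b : V} (h : G.Adj a b)
    (y : V) : G.dist a y ≤ G.dist b y + 1 := by
  have h1 : G.dist a y ≤ G.dist a b + G.dist b y := hG.dist_triangle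
  have h2 : G.dist a b = 1 := SimpleGraph.dist_eq_one_iff_adj.2 h
  omega

theorem edist_eq_dist {G : SimpleGraph V} (hG : G.Connected) (a b : V) :
    G.edist a b = (G.dist a b : ℕ∞) :=
  ((hG a b).coe_dist_eq_edist).symm

theorem edist_le_one_of_adj {K : SimpleGraph V} {a b : V} (h : K.Adj a b) : K.edist a b ≤ 1 :=
  (SimpleGraph.edist_eq_one_iff_adj.2 h).le

/-- A shortest path that avoids `v` survives in every graph that has lost edges at `v` only. -/
theorem edist_le_dist_of_lt {G K : SimpleGraph V} (hG : G.Connected) {v : V}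
    (hK : ∀ x y, G.Adj x y → x ≠ v → y ≠ v → K.Adj x y) {a y : V}
    (h : G.dist a y < G.dist v y) : K.edist a y ≤ (G.dist a y : ℕ∞) := by
  induction hk : G.dist a y generalizing a with
  | zero =>
    obtain rfl := hG.dist_eq_zero_iff.1 hk
    simp
  | succ k ih =>
    have hne : a ≠ y := by
      rintro rfl
      simp at hk
    obtain ⟨z, haz, hz⟩ := exists_adj_dist_add_one hG hne
    have hzk : G.dist z y = k := by omega
    have h1 := ih (a := z) (by omega) hzk
    have hav : a ≠ v := by
      rintro rfl
      omega
    have hzv : z ≠ v := by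
      rintro rfl
      omega
    calc K.edist a y ≤ K.edist a z + K.edist z y := SimpleGraph.edist_triangle
      _ ≤ 1 + (k : ℕ∞) := add_le_add (edist_le_one_of_adj (hK a z haz hav hzv)) h1
      _ = ((k + 1 : ℕ) : ℕ∞) := by push_cast; rw [add_comm]

theorem edist_le_add {K : SimpleGraph V} {a b c : V} {m n : ℕ} (h1 : K.edist a b ≤ (m : ℕ∞))
    (h2 : K.edist b c ≤ (n : ℕ∞)) : K.edist a c ≤ ((m + n : ℕ) : ℕ∞) :=
  SimpleGraph.edist_triangle.trans (by push_cast; exact add_le_add h1 h2)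

/-- If `S` can be left only through `x`, shortest paths into `S` pass through `x`. -/
theorem dist_eq_add_of_cut {G : SimpleGraph V} (hG : G.Connected) {S : Set V} {x : V}
    (hS : ∀ a ∈ S, ∀ b ∉ S, G.Adj a b → a = x) {v y : V} (hv : v ∉ S) (hy : y ∈ S) :
    G.dist v y = G.dist v x + G.dist x y := by
  refine le_antisymm hG.dist_triangle ?_
  obtain ⟨w, hw⟩ := hG.exists_walk_length_eq_dist v y
  rw [← hw]
  clear hw
  induction w with
  | nil => exact absurd hy hv
  | @cons a b c hab q ih =>
    by_cases hb : b ∈ S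
    · obtain rfl := hS b hb a hv hab.symm
      have h1 : G.dist a b = 1 := SimpleGraph.dist_eq_one_iff_adj.2 hab
      have h2 := SimpleGraph.dist_le q
      simp only [SimpleGraph.Walk.length_cons]
      omega
    · have h1 := ih hb hy
      have h2 := dist_le_dist_add_one hG hab x
      simp only [SimpleGraph.Walk.length_cons]
      omega

variable [Fintype V] [DecidableEq V]

theorem IsNashEquilibrium.connected [Nonempty V] {α : ℝ≥0} {s : Profile V}
    (hs : IsNashEquilibrium α s) : (graph s).Connected := by
  refine ⟨fun i j => ?_⟩
  by_contra hij
  have h1 : (graph s).edist i j = ⊤ := by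
    by_contra h
    exact hij (SimpleGraph.reachable_of_edist_ne_top h)
  have h2 : cost α s i = ⊤ := by
    have : ((graph s).edist i j : ℝ≥0∞) ≤ ∑ j : V, ((graph s).edist i j : ℝ≥0∞) :=
      Finset.single_le_sum (f := fun j => ((graph s).edist i j : ℝ≥0∞)) (fun _ _ => zero_le)
        (Finset.mem_univ j)
    rw [h1] at this
    simp only [ENat.toENNReal_top, top_le_iff] at this
    rw [cost, this, add_top]
  -- Buying every edge has finite cost, so an infinite cost is never optimal.
  let t : Strategy i := ⟨Finset.univ.erase i, by simp⟩
  have h3 := hs i t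
  rw [h2, top_le_iff] at h3
  refine absurd h3 (ne_of_lt ?_)
  refine ENNReal.add_lt_top.2 ⟨ENNReal.mul_lt_top (by simp) (by simp), ?_⟩
  refine ENNReal.sum_lt_top.2 fun k _ => ?_
  have h4 : (graph (Function.update s i t)).edist i k ≤ 1 := by
    by_cases hk : k = i
    · subst hk
      simp
    · refine edist_le_one_of_adj (Or.inl ?_)
      simp [t, hk]
  calc ((graph (Function.update s i t)).edist i k : ℝ≥0∞) ≤ ((1 : ℕ∞) : ℝ≥0∞) :=
        ENat.toENNReal_le.2 h4
    _ < ⊤ := by simp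

/-- The equilibrium condition for the deviation of `v` that sells `A` and buys `B`. -/
theorem IsNashEquilibrium.deviate {α : ℝ≥0} {s : Profile V}
    (hs : IsNashEquilibrium α s) (hG : (graph s).Connected) {v : V} {A B : Finset V}
    (hA : A ⊆ (s v).1) (hB : v ∉ B) {f : V → ℕ}
    (hf : ∀ K : SimpleGraph V,
      (∀ x y, (graph s).Adj x y → ¬(x = v ∧ y ∈ A) → ¬(y = v ∧ x ∈ A) → K.Adj x y) →
      (∀ y ∈ B, K.Adj v y) → ∀ y, K.edist v y ≤ (f y : ℕ∞)) :
    (α : ℝ) * A.card + ((∑ y, (graph s).dist v y : ℕ) : ℝ) ≤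
      (α : ℝ) * B.card + ((∑ y, f y : ℕ) : ℝ) := by
  let t : Strategy v := ⟨((s v).1 \ A) ∪ B, by simp [hB, (s v).2]⟩
  -- A sold edge survives if its other end buys it too, so the new graph is only bounded from below.
  have hK := hf (graph (Function.update s v t)) (by
    have key : ∀ x y, y ∈ (s x).1 → ¬(x = v ∧ y ∈ A) → y ∈ (Function.update s v t x).1 := by
      intro x y h1 h2
      by_cases hx : x = v
      · subst hx
        have h3 : y ∉ A := fun h => h2 ⟨rfl, h⟩
        simp [t, h1, h3]
      · simpa [Function.update_of_ne hx] using h1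
    intro x y hxy h1 h2
    exact hxy.imp (fun h => key x y h h1) (fun h => key y x h h2)) (by
    intro y hy
    exact Or.inl (by simp [t, hy]))
  have hcard : t.1.card + A.card ≤ (s v).1.card + B.card := by
    have h1 := Finset.card_union_le ((s v).1 \ A) B
    have h2 := Finset.card_sdiff_add_card_eq_card hA
    have h3 : t.1.card = (((s v).1 \ A) ∪ B).card := rfl
    omega
  have h1 := hs v t
  have h2 : cost α s v =
      ((α * ((s v).1.card : ℝ≥0) + ((∑ y, (graph s).dist v y : ℕ) : ℝ≥0) : ℝ≥0) : ℝ≥0∞) := by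
    simp [cost, edist_eq_dist hG]
  have h3 : cost α (Function.update s v t) v ≤
      ((α * (t.1.card : ℝ≥0) + ((∑ y, f y : ℕ) : ℝ≥0) : ℝ≥0) : ℝ≥0∞) := by
    have h4 : ∑ y, ((graph (Function.update s v t)).edist v y : ℝ≥0∞) ≤ ∑ y, (f y : ℝ≥0∞) := by
      refine Finset.sum_le_sum fun y _ => ?_
      simpa using ENat.toENNReal_le.2 (hK y)
    simp only [cost, Function.update_self]
    push_cast
    gcongr
  rw [h2] at h1
  have h5 := ENNReal.coe_le_coe.1 (h1.trans h3)
  have h6 : (α : ℝ) * (s v).1.card + ((∑ y, (graph s).dist v y : ℕ) : ℝ) ≤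
      (α : ℝ) * t.1.card + ((∑ y, f y : ℕ) : ℝ) := by exact_mod_cast h5
  have h7 : (t.1.card : ℝ) + A.card ≤ (s v).1.card + B.card := by exact_mod_cast hcard
  have h8 := mul_le_mul_of_nonneg_left h7 α.coe_nonneg
  linarith

end NetworkCreation

/-! ### Breadth-first trees -/

namespace NetworkCreation

section ParentMap

variable {V : Type*} {G : SimpleGraph V} {r : V} {p : V → V}

/-- `p` maps every vertex to its parent in a breadth-first search tree of `G` rooted at `r`. -/
structure IsParentMap (G : SimpleGraph V) (r : V) (p : V → V) : Prop where
  root : p r = r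
  adj : ∀ v, v ≠ r → G.Adj v (p v)
  -- Truncated subtraction makes this hold at the root as well.
  dist : ∀ v, G.dist r (p v) = G.dist r v - 1

theorem exists_isParentMap (hG : G.Connected) (r : V) : ∃ p, IsParentMap G r p := by
  have h : ∀ v, ∃ z, (v = r → z = r) ∧ (v ≠ r → G.Adj v z) ∧ G.dist r z = G.dist r v - 1 := by
    intro v
    by_cases hv : v = r
    · exact ⟨r, by simp [hv]⟩
    · obtain ⟨z, h1, h2⟩ := exists_adj_dist_add_one hG hv
      rw [G.dist_comm (u := z), G.dist_comm (u := v)] at h2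
      exact ⟨z, fun h => absurd h hv, fun _ => h1, by omega⟩
  choose p h1 h2 h3 using h
  exact ⟨p, h1 r rfl, h2, h3⟩

/-- The vertices of the subtree below `x`. -/
def IsBelow (p : V → V) (x y : V) : Prop := ∃ k, p^[k] y = x

theorem isBelow_iterate (p : V → V) (k : ℕ) (y : V) : IsBelow p (p^[k] y) y := ⟨k, rfl⟩

theorem isBelow_refl (p : V → V) (x : V) : IsBelow p x x := ⟨0, rfl⟩

theorem IsBelow.trans {x y z : V} (h1 : IsBelow p x y) (h2 : IsBelow p y z) : IsBelow p x z := by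
  obtain ⟨k, rfl⟩ := h1
  obtain ⟨l, rfl⟩ := h2
  exact ⟨k + l, by rw [Function.iterate_add_apply]⟩

theorem IsBelow.parent {x y : V} (h : IsBelow p x y) (hne : y ≠ x) : IsBelow p x (p y) := by
  obtain ⟨k, hk⟩ := h
  cases k with
  | zero => exact absurd hk hne
  | succ k => exact ⟨k, hk⟩

namespace IsParentMap

theorem dist_iterate (hp : IsParentMap G r p) (k : ℕ) (y : V) :
    G.dist r (p^[k] y) = G.dist r y - k := by
  induction k with
  | zero => simp
  | succ k ih =>
    rw [Function.iterate_succ_apply', hp.dist, ih]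
    omega

theorem iterate_dist (hp : IsParentMap G r p) (hG : G.Connected) (y : V) :
    p^[G.dist r y] y = r := by
  have h := hp.dist_iterate (G.dist r y) y
  rw [Nat.sub_self] at h
  exact (hG.dist_eq_zero_iff.1 h).symm

theorem isBelow_root (hp : IsParentMap G r p) (hG : G.Connected) (y : V) : IsBelow p r y :=
  ⟨_, hp.iterate_dist hG y⟩

theorem dist_le_of_isBelow (hp : IsParentMap G r p) {x y : V} (h : IsBelow p x y) :
    G.dist r x ≤ G.dist r y := by
  obtain ⟨k, rfl⟩ := h
  rw [hp.dist_iterate]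
  omega

theorem iterate_sub_of_isBelow (hp : IsParentMap G r p) (hG : G.Connected) {x y : V}
    (h : IsBelow p x y) : p^[G.dist r y - G.dist r x] y = x := by
  obtain ⟨k, rfl⟩ := h
  rw [hp.dist_iterate]
  rcases le_total k (G.dist r y) with hk | hk
  · rw [Nat.sub_sub_self hk]
  · have h1 := hp.dist_iterate k y
    rw [Nat.sub_eq_zero_of_le hk] at h1 ⊢
    rw [Nat.sub_zero, hp.iterate_dist hG]
    exact hG.dist_eq_zero_iff.1 h1

theorem ne_root_of_dist_pos {x : V} (h : 0 < G.dist r x) : x ≠ r := by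
  rintro rfl
  simp at h

theorem edist_iterate_le {K : SimpleGraph V} {y : V} {k : ℕ}
    (hK : ∀ i < k, K.Adj (p^[i] y) (p (p^[i] y))) : K.edist y (p^[k] y) ≤ (k : ℕ∞) := by
  induction k with
  | zero => simp
  | succ k ih =>
    rw [Function.iterate_succ_apply']
    exact edist_le_add (n := 1) (ih fun i hi => hK i (by omega))
      (by simpa using edist_le_one_of_adj (hK k (by omega)))

theorem adj_iterate (hp : IsParentMap G r p) {y : V} {i : ℕ} (hi : i < G.dist r y) :
    G.Adj (p^[i] y) (p (p^[i] y)) := by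
  refine hp.adj _ (ne_root_of_dist_pos (G := G) ?_)
  rw [hp.dist_iterate]
  omega

theorem edist_le_of_isBelow (hp : IsParentMap G r p) (hG : G.Connected) {K : SimpleGraph V}
    {x y : V} (h : IsBelow p x y)
    (hK : ∀ a, IsBelow p a y → G.dist r x < G.dist r a → G.Adj a (p a) → K.Adj a (p a)) :
    K.edist y x ≤ ((G.dist r y - G.dist r x : ℕ) : ℕ∞) := by
  have h1 := hp.iterate_sub_of_isBelow hG h
  have h2 := edist_iterate_le (p := p) (K := K) (y := y) (k := G.dist r y - G.dist r x)
    fun i hi => hK _ (isBelow_iterate p i y) (by rw [hp.dist_iterate]; omega)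
      (hp.adj_iterate (by omega))
  rwa [h1] at h2

theorem dist_of_isBelow (hp : IsParentMap G r p) (hG : G.Connected) {x y : V}
    (h : IsBelow p x y) : G.dist x y = G.dist r y - G.dist r x := by
  have h1 := hp.edist_le_of_isBelow hG h (K := G) fun _ _ _ h => h
  rw [edist_eq_dist hG, Nat.cast_le, G.dist_comm] at h1
  have h2 : G.dist r y ≤ G.dist r x + G.dist x y := hG.dist_triangle
  omega

theorem isBelow_antisymm_of_dist_le (hp : IsParentMap G r p) (hG : G.Connected) {x y : V}
    (h : IsBelow p x y) (hd : G.dist r y ≤ G.dist r x) : y = x := by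
  have := hp.iterate_sub_of_isBelow hG h
  rwa [Nat.sub_eq_zero_of_le hd] at this

/-- Outside of the subtree of `v`, tree paths to the root survive in every graph that has lost
edges at `v` only. -/
theorem edist_root_le (hp : IsParentMap G r p) (hG : G.Connected) {K : SimpleGraph V} {v y : V}
    (hK : ∀ x y, G.Adj x y → x ≠ v → y ≠ v → K.Adj x y) (hy : ¬IsBelow p v y) :
    K.edist y r ≤ (G.dist r y : ℕ∞) := by
  have h := hp.edist_le_of_isBelow hG (K := K) (hp.isBelow_root hG y) (fun a ha _ hadj =>
    hK _ _ hadj (by rintro rfl; exact hy ha) (by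
      rintro rfl
      exact hy (IsBelow.trans ⟨1, rfl⟩ ha)))
  simpa using h

/-- Strictly below `v`, tree paths survive in every graph that has lost edges at `v` only. -/
theorem edist_le_of_isBelow_of_lt (hp : IsParentMap G r p) (hG : G.Connected)
    {K : SimpleGraph V} {v x y : V}
    (hK : ∀ x y, G.Adj x y → x ≠ v → y ≠ v → K.Adj x y) (h : IsBelow p x y)
    (hv : G.dist r v < G.dist r x) : K.edist y x ≤ ((G.dist r y - G.dist r x : ℕ) : ℕ∞) := by
  refine hp.edist_le_of_isBelow hG h fun a _ ha hadj => hK _ _ hadj ?_ ?_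
  · rintro rfl
    omega
  · rintro rfl
    have := hp.dist a
    omega

end IsParentMap

end ParentMap

/-! ### Chords and loose edges -/

variable {V : Type*} [Fintype V] [DecidableEq V] {α : ℝ≥0} {s : Profile V} {r : V} {p : V → V}

/-- Player `u` buys the edge to `w`, which is not an edge of the tree given by `p`. -/
def BuysChord (s : Profile V) (p : V → V) (u w : V) : Prop :=
  w ∈ (s u).1 ∧ p u ≠ w ∧ p w ≠ u

omit [Fintype V] [DecidableEq V] in
theorem adj_of_mem {v w : V} (h : w ∈ (s v).1) : (graph s).Adj v w := Or.inl h

omit [Fintype V] [DecidableEq V] in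
theorem BuysChord.adj {u w : V} (h : BuysChord s p u w) : (graph s).Adj u w := adj_of_mem h.1

section Deviations

variable (hs : IsNashEquilibrium α s) (hG : (graph s).Connected)
  (hα : 65 * (Fintype.card V : ℝ) ≤ α) (hp : IsParentMap (graph s) r p)

include hs hG hα hp

/-- Otherwise `u` could sell the chord and reach `w` through the tree, via the common ancestor
`p^[j] u`. This saves `α` and adds at most 43 to each distance. -/
theorem BuysChord.not_isBelow {u w : V} (h : BuysChord s p u w) {j : ℕ} (hj : j ≤ 21) :
    ¬IsBelow p (p^[j] u) w := by
  intro hw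
  have hx := isBelow_iterate p j u
  set x := p^[j] u with hxdef
  have hdx : (graph s).dist r x = (graph s).dist r u - j := hp.dist_iterate j u
  have hdw : (graph s).dist r w ≤ (graph s).dist r u + 1 := by
    have := dist_le_dist_add_one hG h.adj.symm r
    rwa [(graph s).dist_comm (u := w), (graph s).dist_comm (u := u)] at this
  -- The tree path climbs at most 21 edges and, as `w` is at most one level deeper than `u`,
  -- descends at most 22.
  have hdev := hs.deviate hG (v := u) (A := {w}) (B := ∅)
    (f := fun y => (graph s).dist u y + 43) (by simpa using h.1) (by simp) (by
    intro K hK _ y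
    have hK' : ∀ x y, (graph s).Adj x y → x ≠ u → y ≠ u → K.Adj x y := fun x y hxy h1 h2 =>
      hK x y hxy (fun h => h1 h.1) (fun h => h2 h.1)
    have htree : ∀ a, (graph s).Adj a (p a) → K.Adj a (p a) := fun a ha =>
      hK _ _ ha (by
        rintro ⟨rfl, h3⟩
        exact h.2.1 (by simpa using h3)) (by
        rintro ⟨h3, h4⟩
        rw [Finset.mem_singleton.1 h4] at h3
        exact h.2.2 h3)
    have huw : K.edist u w ≤ (43 : ℕ) := by
      have h1 := hp.edist_le_of_isBelow hG hx fun a _ _ => htree a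
      have h2 := hp.edist_le_of_isBelow hG hw fun a _ _ => htree a
      rw [SimpleGraph.edist_comm] at h2
      refine (edist_le_add h1 h2).trans ?_
      rw [Nat.cast_le]
      omega
    by_cases hy : u = y
    · subst hy
      simp
    -- After its first edge, a shortest path from `u` never returns to `u`, so only that edge can
    -- need the detour.
    obtain ⟨z, huz, hz⟩ := exists_adj_dist_add_one hG hy
    have hzy := edist_le_dist_of_lt hG hK' (a := z) (y := y) (by omega)
    have h3 : K.edist u z ≤ (43 : ℕ) := by
      by_cases hzw : z = w
      · rwa [hzw]
      · refine (edist_le_one_of_adj (hK u z huz (by simpa using hzw) ?_)).trans (by norm_num)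
        rintro ⟨rfl, -⟩
        exact huz.ne rfl
    refine (edist_le_add h3 hzy).trans ?_
    rw [Nat.cast_le]
    omega)
  have hpos : (0 : ℝ) < Fintype.card V := by
    exact_mod_cast Fintype.card_pos_iff.2 ⟨u⟩
  simp only [Finset.sum_add_distrib, Finset.sum_const, Finset.card_univ, smul_eq_mul,
    Finset.card_singleton, Finset.card_empty] at hdev
  push_cast at hdev
  linarith

theorem BuysChord.lt_dist {u w : V} (h : BuysChord s p u w) : 21 < (graph s).dist r u := by
  by_contra hd
  refine h.not_isBelow hs hG hα hp (not_lt.1 hd) ?_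
  rw [hp.iterate_dist hG]
  exact hp.isBelow_root hG w

/-- If `v` loses edges but is connected to the root directly, the subtree that contains the end
of a nearby chord is reached through this chord. -/
theorem BuysChord.edist_le {u w : V} (h : BuysChord s p u w) {a : ℕ} (ha : a + 1 ≤ 21)
    {K : SimpleGraph V}
    (hK : ∀ x y, (graph s).Adj x y → x ≠ p^[a + 1] u → y ≠ p^[a + 1] u → K.Adj x y)
    (hr : K.Adj (p^[a + 1] u) r) {y : V} (hy : IsBelow p (p^[a] u) y) :
    K.edist (p^[a + 1] u) y ≤ (((graph s).dist r y + 1 + 2 * (a + 1) : ℕ) : ℕ∞) := by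
  have hw := h.not_isBelow hs hG hα hp ha
  have hdv := hp.dist_iterate (a + 1) u
  have hdz := hp.dist_iterate a u
  have hdu := h.lt_dist hs hG hα hp
  have hdy := hp.dist_le_of_isBelow hy
  have hbu := isBelow_iterate p a u
  set v := p^[a + 1] u
  set z := p^[a] u
  have hdw : (graph s).dist r w ≤ (graph s).dist r u + 1 := by
    have := dist_le_dist_add_one hG h.adj.symm r
    rwa [(graph s).dist_comm (u := w), (graph s).dist_comm (u := u)] at this
  have h1 : K.edist v r ≤ (1 : ℕ) := by simpa using edist_le_one_of_adj hr
  have h2 := hp.edist_root_le hG hK hw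
  have h3 : K.edist w u ≤ (1 : ℕ) := by
    have : K.Adj w u := hK _ _ h.adj.symm (by
      intro hwv
      exact hw (hwv ▸ isBelow_refl p v)) (by
      intro huv
      rw [← huv] at hdv
      omega)
    simpa using edist_le_one_of_adj this
  have h4 := hp.edist_le_of_isBelow_of_lt hG hK hbu (by omega)
  have h5 := hp.edist_le_of_isBelow_of_lt hG hK hy (by omega)
  rw [SimpleGraph.edist_comm] at h2 h5
  refine (edist_le_add (edist_le_add (edist_le_add (edist_le_add h1 h2) h3) h4) h5).trans ?_
  rw [Nat.cast_le]
  omega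

end Deviations

/-- The edge from `v` to `z` is not needed by `v` once `v` has an edge to the root: it does not
go to a child, or it goes to a child whose subtree has a chord bought close to `v`. -/
def IsLoose (s : Profile V) (p : V → V) (v z : V) : Prop :=
  p z ≠ v ∨ ∃ u w a, BuysChord s p u w ∧ a + 1 ≤ 21 ∧ p^[a] u = z ∧ p^[a + 1] u = v

omit [Fintype V] [DecidableEq V] in
theorem BuysChord.isLoose {u w : V} (h : BuysChord s p u w) : IsLoose s p u w := Or.inl h.2.2

/-- With two loose edges, `v` would sell both and buy one edge to `r`. By minimality of `r`, the
distance sum grows by at most `43 n`, less than the price `α` saved. -/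
theorem eq_of_isLoose (hs : IsNashEquilibrium α s) (hG : (graph s).Connected)
    (hα : 65 * (Fintype.card V : ℝ) ≤ α) (hp : IsParentMap (graph s) r p)
    (hr : ∀ v, ∑ y, (graph s).dist r y ≤ ∑ y, (graph s).dist v y)
    {v z z' : V} (hv : v ≠ r) (hz : z ∈ (s v).1) (hz' : z' ∈ (s v).1)
    (hl : IsLoose s p v z) (hl' : IsLoose s p v z') : z = z' := by
  by_contra hne
  -- The worst detour goes through the root and back over a chord: `1 + 2 * 21 = 43` more than the
  -- distance from `r`.
  have hdev := hs.deviate hG (v := v) (A := {z, z'}) (B := {r})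
    (f := fun y => (graph s).dist r y + 43)
    (by simp [Finset.insert_subset_iff, hz, hz']) (by simpa using hv) (by
    intro K hK hKr y
    have hK' : ∀ x y, (graph s).Adj x y → x ≠ v → y ≠ v → K.Adj x y := fun x y hxy h1 h2 =>
      hK x y hxy (fun h => h1 h.1) (fun h => h2 h.1)
    have hvr : K.Adj v r := hKr r (by simp)
    have hchild : ∀ c, IsLoose s p v c → p c = v → IsBelow p c y →
        K.edist v y ≤ (((graph s).dist r y + 43 : ℕ) : ℕ∞) := by
      rintro c (hc | ⟨u, w, a, huw, ha, rfl, rfl⟩) hcv hcy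
      · exact absurd hcv hc
      · refine (huw.edist_le hs hG hα hp ha hK' hvr hcy).trans ?_
        rw [Nat.cast_le]
        omega
    by_cases hvy : IsBelow p v y
    · by_cases h1 : p z = v ∧ IsBelow p z y
      · exact hchild z hl h1.1 h1.2
      by_cases h2 : p z' = v ∧ IsBelow p z' y
      · exact hchild z' hl' h2.1 h2.2
      have h3 := hp.edist_le_of_isBelow hG (K := K) hvy (fun a ha hda hadj => hK _ _ hadj (by
        rintro ⟨rfl, -⟩
        omega) (by
        rintro ⟨h3, h4⟩
        rcases Finset.mem_insert.1 h4 with rfl | h4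
        · exact h1 ⟨h3, ha⟩
        · rw [Finset.mem_singleton.1 h4] at h3 ha
          exact h2 ⟨h3, ha⟩))
      rw [SimpleGraph.edist_comm]
      refine h3.trans ?_
      rw [Nat.cast_le]
      omega
    · have h1 := hp.edist_root_le hG hK' hvy
      rw [SimpleGraph.edist_comm] at h1
      have h2 : K.edist v r ≤ (1 : ℕ) := by simpa using edist_le_one_of_adj hvr
      refine (edist_le_add h2 h1).trans ?_
      rw [Nat.cast_le]
      omega)
  have hpos : (0 : ℝ) < Fintype.card V := by
    exact_mod_cast Fintype.card_pos_iff.2 ⟨r⟩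
  have hD : ((∑ y, (graph s).dist r y : ℕ) : ℝ) ≤ (∑ y, (graph s).dist v y : ℕ) := by
    exact_mod_cast hr v
  simp only [Finset.sum_add_distrib, Finset.sum_const, Finset.card_univ, smul_eq_mul,
    Finset.card_singleton, Finset.card_pair hne] at hdev
  push_cast at hdev hD
  linarith

end NetworkCreation

/-! ### Bridges and tree edges -/

namespace NetworkCreation

section Bridges

variable {V : Type*} {G : SimpleGraph V} {r : V} {p : V → V}

theorem reachable_of_edist_le {K : SimpleGraph V} {a b : V} {k : ℕ}
    (h : K.edist a b ≤ (k : ℕ∞)) : K.Reachable a b :=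
  SimpleGraph.reachable_of_edist_ne_top fun h1 => by
    rw [h1, top_le_iff] at h
    exact ENat.natCast_ne_top k h

namespace IsParentMap

theorem dist_pos (hG : G.Connected) {v : V} (hv : v ≠ r) : 0 < G.dist r v :=
  hG.pos_dist_of_ne hv.symm

theorem adj_deleteEdges (hp : IsParentMap G r p) (hG : G.Connected) {a c : V} (hc : c ≠ r)
    (hac : a ≠ c) (h : G.Adj a (p a)) : (G.deleteEdges {s(c, p c)}).Adj a (p a) := by
  rw [SimpleGraph.deleteEdges_adj]
  refine ⟨h, fun h1 => ?_⟩
  rw [Set.mem_singleton_iff, Sym2.eq_iff] at h1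
  rcases h1 with h1 | ⟨h1, h2⟩
  · exact hac h1.1
  · have h3 := dist_pos hG hc
    have h4 := hp.dist c
    have h5 := hp.dist a
    rw [h2] at h5
    rw [← h1] at h4
    omega

/-- An edge that leaves the subtree of `c` makes the tree edge above `c` lie on a cycle. -/
theorem not_isBridge_of_adj (hp : IsParentMap G r p) (hG : G.Connected) {a b c : V}
    (hc : c ≠ r) (hab : G.Adj a b) (ha : IsBelow p c a) (hb : ¬IsBelow p c b)
    (hne : ¬(a = c ∧ b = p c)) : ¬G.IsBridge s(c, p c) := by
  rw [SimpleGraph.isBridge_iff, not_not]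
  set K := G.deleteEdges {s(c, p c)} with hK
  have h1 : K.Reachable a c := reachable_of_edist_le
    (hp.edist_le_of_isBelow hG ha fun x _ hx => hp.adj_deleteEdges hG hc
      (by rintro rfl; omega))
  have h2 : K.Adj a b := by
    rw [hK, SimpleGraph.deleteEdges_adj]
    refine ⟨hab, fun h3 => ?_⟩
    rw [Set.mem_singleton_iff, Sym2.eq_iff] at h3
    rcases h3 with h3 | ⟨-, h3⟩
    · exact hne h3
    · exact hb (h3 ▸ isBelow_refl p c)
  have h3 : K.Reachable b r := reachable_of_edist_le
    (hp.edist_le_of_isBelow hG (hp.isBelow_root hG b) fun x hx _ =>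
      hp.adj_deleteEdges hG hc (by rintro rfl; exact hb hx))
  have h4 : K.Reachable (p c) r := reachable_of_edist_le
    (hp.edist_le_of_isBelow hG (hp.isBelow_root hG (p c)) fun x hx _ =>
      hp.adj_deleteEdges hG hc (by
        rintro rfl
        have h5 := hp.dist_le_of_isBelow hx
        have h6 := hp.dist x
        have h7 := dist_pos hG hc
        omega))
  exact ((h1.symm.trans h2.reachable).trans h3).trans h4.symm

theorem not_isBridge_of_chord (hp : IsParentMap G r p) (hG : G.Connected) {a b : V}
    (hab : G.Adj a b) (h1 : p a ≠ b) (h2 : p b ≠ a) : ¬G.IsBridge s(a, b) := by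
  rw [SimpleGraph.isBridge_iff, not_not]
  have h : ∀ y, (G.deleteEdges {s(a, b)}).Reachable y r := fun y => reachable_of_edist_le
    (hp.edist_le_of_isBelow hG (hp.isBelow_root hG y) fun x _ _ hadj => by
      rw [SimpleGraph.deleteEdges_adj]
      refine ⟨hadj, fun h3 => ?_⟩
      rw [Set.mem_singleton_iff, Sym2.eq_iff] at h3
      rcases h3 with ⟨rfl, h3⟩ | ⟨rfl, h3⟩
      · exact h1 h3
      · exact h2 h3)
  exact (h a).trans (h b).symm

/-- If all edges at `v` but those to its parent and to its child `c` are bridges, then what hangs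
at `v` between these two edges can be left only along them. -/
theorem eq_of_adj_of_bridges (hp : IsParentMap G r p) (hG : G.Connected) {v c : V}
    (hcv : p c = v) (hcr : c ≠ r)
    (hbr : ∀ b, G.Adj v b → b ≠ c → b ≠ p v → G.IsBridge s(v, b)) {a b : V}
    (hav : IsBelow p v a) (hac : ¬IsBelow p c a) (hb : ¬(IsBelow p v b ∧ ¬IsBelow p c b))
    (hab : G.Adj a b) : a = v ∧ (b = c ∨ b = p v) := by
  have hdc := hp.dist c
  have hdc' := dist_pos hG hcr
  rw [hcv] at hdc
  have hnc : ∀ x, p x = v → IsBelow p c x → x = c := by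
    intro x hx hcx
    refine hp.isBelow_antisymm_of_dist_le hG hcx ?_
    have h1 := hp.dist x
    rw [hx] at h1
    omega
  by_cases hva : a = v
  · subst hva
    refine ⟨rfl, ?_⟩
    by_contra! hne
    have h1 := hbr b hab hne.1 hne.2
    by_cases h2 : p b = a
    · exact hb ⟨IsBelow.trans ⟨0, rfl⟩ ⟨1, h2⟩, fun h3 => hne.1 (hnc b h2 h3)⟩
    · exact hp.not_isBridge_of_chord hG hab (Ne.symm hne.2) h2 h1
  · exfalso
    obtain ⟨k, hk⟩ := hav
    -- The child `x` of `v` above `a` differs from `c`, so its edge to `v` is a bridge by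
    -- assumption; but the edge `a b` leaves the subtree of `x`.
    have hex : ∃ x, IsBelow p x a ∧ p x = v ∧ x ≠ v := by
      clear hac hb hab
      induction k generalizing a with
      | zero => exact absurd hk hva
      | succ k ih =>
        by_cases h1 : p a = v
        · exact ⟨a, isBelow_refl p a, h1, hva⟩
        · obtain ⟨x, h2, h3⟩ := ih h1 hk
          exact ⟨x, h2.trans ⟨1, rfl⟩, h3⟩
    obtain ⟨x, hxa, hxv, hne⟩ := hex
    have hxc : x ≠ c := by
      rintro rfl
      exact hac hxa
    have hxr : x ≠ r := by
      rintro rfl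
      rw [hp.root] at hxv
      exact hne hxv
    have hadj : G.Adj v x := by
      have := hp.adj x hxr
      rw [hxv] at this
      exact this.symm
    have hxp : x ≠ p v := by
      intro h1
      have h2 := hp.dist x
      have h3 := hp.dist v
      have h4 := dist_pos hG hxr
      rw [hxv] at h2
      rw [← h1] at h3
      omega
    have hbx : ¬IsBelow p x b := by
      intro h1
      refine hb ⟨IsBelow.trans ⟨1, hxv⟩ h1, fun h2 => ?_⟩
      have h3 := hp.iterate_sub_of_isBelow hG h1
      have h4 := hp.iterate_sub_of_isBelow hG h2
      have h5 := hp.dist x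
      have h7 := dist_pos hG hxr
      rw [hxv] at h5
      have h10 : G.dist r x = G.dist r c := by omega
      rw [h10] at h3
      exact hxc (h3.symm.trans h4)
    have h1 := hp.not_isBridge_of_adj hG hxr hab hxa hbx (by
      rintro ⟨-, h2⟩
      rw [hxv] at h2
      subst h2
      refine hb ⟨isBelow_refl p b, fun h3 => ?_⟩
      exact hac ((h3.trans ⟨1, hxv⟩).trans hxa))
    rw [hxv, Sym2.eq_swap] at h1
    exact h1 (hbr x hadj hxc hxp)

variable (hp : IsParentMap G r p) (hG : G.Connected) {v c : V} (hcv : p c = v) (hcr : c ≠ r)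
  (hbr : ∀ b, G.Adj v b → b ≠ c → b ≠ p v → G.IsBridge s(v, b))

include hp hG hcv hcr

theorem not_isBelow_child : ¬IsBelow p c v := by
  intro h
  have h1 := hp.dist_le_of_isBelow h
  have h2 := hp.dist c
  have h3 := dist_pos hG hcr
  rw [hcv] at h2
  omega

include hbr

theorem dist_eq_add_one_of_hanging {y b : V} (hy : IsBelow p v y) (hy' : ¬IsBelow p c y)
    (hvb : G.Adj v b) (hb : ¬(IsBelow p v b ∧ ¬IsBelow p c b)) :
    G.dist b y = G.dist v y + 1 := by
  have h := dist_eq_add_of_cut hG (S := {y | IsBelow p v y ∧ ¬IsBelow p c y}) (x := v)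
    (fun a ha b hb hab => (hp.eq_of_adj_of_bridges hG hcv hcr hbr ha.1 ha.2 hb hab).1)
    (v := b) (y := y) hb ⟨hy, hy'⟩
  rw [SimpleGraph.dist_eq_one_iff_adj.2 hvb.symm] at h
  omega

/-- A shortest path from `v` to `y` cannot start into the hanging part, since it would have to come
back through `v`. -/
theorem dist_eq_of_not_hanging {y : V} (hy : ¬(IsBelow p v y ∧ ¬IsBelow p c y)) :
    G.dist v y = G.dist c y + 1 ∨ G.dist v y = G.dist (p v) y + 1 := by
  have hv := hp.not_isBelow_child hG hcv hcr
  have hne : v ≠ y := by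
    rintro rfl
    exact hy ⟨isBelow_refl p v, hv⟩
  obtain ⟨z, hvz, hz⟩ := exists_adj_dist_add_one hG hne
  by_cases hzS : IsBelow p v z ∧ ¬IsBelow p c z
  · exfalso
    have h := dist_eq_add_of_cut hG (S := {y | IsBelow p v y ∧ ¬IsBelow p c y}) (x := v)
      (fun a ha b hb hab => (hp.eq_of_adj_of_bridges hG hcv hcr hbr ha.1 ha.2 hb hab).1)
      (v := y) (y := z) hy hzS
    rw [G.dist_comm (u := y), G.dist_comm (u := y)] at h
    omega
  · rcases (hp.eq_of_adj_of_bridges hG hcv hcr hbr (isBelow_refl p v) hv hzS hvz).2 with rfl | rfl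
    · exact Or.inl hz.symm
    · exact Or.inr hz.symm

end IsParentMap

end Bridges

variable {V : Type*} [Fintype V] [DecidableEq V] {α : ℝ≥0} {s : Profile V} {r : V} {p : V → V}

/-! ### Disjoint chains above chord owners -/

section Chains

variable (hs : IsNashEquilibrium α s) (hG : (graph s).Connected)
  (hα : 65 * (Fintype.card V : ℝ) ≤ α) (hp : IsParentMap (graph s) r p)
  (hr : ∀ v, ∑ y, (graph s).dist r y ≤ ∑ y, (graph s).dist v y)

include hs hG hα hp

theorem BuysChord.iterate_ne_root {u w : V} (h : BuysChord s p u w) {i : ℕ} (hi : i ≤ 21) :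
    p^[i] u ≠ r := by
  have h1 := h.lt_dist hs hG hα hp
  have h2 := hp.dist_iterate i u
  intro h3
  rw [h3] at h2
  simp at h2
  omega

/-- The chord leaves the subtree of `p^[i] u`, so it closes a cycle through the tree edge above. -/
theorem BuysChord.not_isBridge {u w : V} (h : BuysChord s p u w) {i : ℕ} (hi : i ≤ 21) :
    ¬(graph s).IsBridge s(p^[i] u, p^[i + 1] u) := by
  rw [Function.iterate_succ_apply']
  refine hp.not_isBridge_of_adj hG (h.iterate_ne_root hs hG hα hp hi) h.adj
    (isBelow_iterate p i u) (h.not_isBelow hs hG hα hp hi) ?_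
  rintro ⟨h1, h2⟩
  rw [← h1] at h2
  exact h.2.1 h2.symm

include hr

theorem BuysChord.unique {u w w' : V} (h : BuysChord s p u w) (h' : BuysChord s p u w') :
    w = w' :=
  eq_of_isLoose hs hG hα hp hr (h.iterate_ne_root hs hG hα hp (i := 0) (by norm_num)) h.1 h'.1
    h.isLoose h'.isLoose

/-- All edges close above a chord are bought by their upper end. -/
theorem BuysChord.mem_iterate {u w : V} (h : BuysChord s p u w) {i : ℕ} (hi : i + 1 ≤ 21) :
    p^[i] u ∈ (s (p^[i + 1] u)).1 := by
  have hdu := h.lt_dist hs hG hα hp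
  -- An edge to the parent is loose. A vertex that already buys another loose edge thus leaves it to
  -- the parent, for which it is loose again.
  have key : ∀ i, i + 1 ≤ 21 → ∀ z, z ∈ (s (p^[i] u)).1 → IsLoose s p (p^[i] u) z →
      z ≠ p (p^[i] u) → p^[i] u ∈ (s (p^[i + 1] u)).1 := by
    intro i hi z hz hl hne
    have hroot := h.iterate_ne_root hs hG hα hp (i := i) (by omega)
    have hd := hp.dist_iterate i u
    have hd2 := hp.dist_iterate (i + 2) u
    rw [Function.iterate_succ_apply', Function.iterate_succ_apply'] at hd2
    rw [Function.iterate_succ_apply']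
    refine (hp.adj _ hroot).resolve_left fun h1 => hne ?_
    refine eq_of_isLoose hs hG hα hp hr hroot hz h1 hl (Or.inl fun h2 => ?_)
    rw [h2] at hd2
    omega
  induction i with
  | zero => exact key 0 hi w h.1 h.isLoose h.2.1.symm
  | succ i ih =>
    refine key _ hi _ (ih (by omega)) (Or.inr ⟨u, w, i, h, by omega, rfl, rfl⟩) fun h1 => ?_
    have hd := hp.dist_iterate i u
    have hd2 := hp.dist_iterate (i + 2) u
    rw [Function.iterate_succ_apply', ← h1] at hd2
    omega

/-- The unique loose edge bought at a common vertex determines the next vertex down in both chains.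
They descend together and must end together, because at an owner the loose edge is a chord and not a
tree edge. -/
theorem BuysChord.eq_of_iterate_eq {u w u' w' : V} (h : BuysChord s p u w)
    (h' : BuysChord s p u' w') {i j : ℕ} (hi : i ≤ 21) (hj : j ≤ 21)
    (hij : p^[i] u = p^[j] u') : u = u' := by
  induction i generalizing j with
  | zero =>
    cases j with
    | zero => exact hij
    | succ j =>
      exfalso
      have h1 := h'.mem_iterate hs hG hα hp hr hj
      have h2 : u = p^[j + 1] u' := hij
      have hroot := h.iterate_ne_root hs hG hα hp (i := 0) (by norm_num)
      rw [← h2] at h1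
      have h3 := eq_of_isLoose hs hG hα hp hr hroot h.1 h1 h.isLoose
        (Or.inr ⟨u', w', j, h', hj, rfl, h2.symm⟩)
      rw [Function.iterate_succ_apply', ← h3] at h2
      exact h.2.2 h2.symm
  | succ i ih =>
    cases j with
    | zero =>
      exfalso
      have h1 := h.mem_iterate hs hG hα hp hr hi
      have h2 : p^[i + 1] u = u' := hij
      have hroot := h'.iterate_ne_root hs hG hα hp (i := 0) (by norm_num)
      rw [h2] at h1
      have h3 := eq_of_isLoose hs hG hα hp hr hroot h'.1 h1 h'.isLoose
        (Or.inr ⟨u, w, i, h, hi, rfl, h2⟩)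
      rw [Function.iterate_succ_apply', ← h3] at h2
      exact h'.2.2 h2
    | succ j =>
      have h1 := h.mem_iterate hs hG hα hp hr hi
      have h2 := h'.mem_iterate hs hG hα hp hr hj
      rw [← hij] at h2
      exact ih (by omega) (by omega) (eq_of_isLoose hs hG hα hp hr
        (h.iterate_ne_root hs hG hα hp hi) h1 h2 (Or.inr ⟨u, w, i, h, hi, rfl, rfl⟩)
        (Or.inr ⟨u', w', j, h', hj, rfl, hij.symm⟩))

end Chains

end NetworkCreation

/-! ### Swaps and distance sums along a chain -/

namespace NetworkCreation

open Classical in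
/-- The subtree below `x`, as a finite set. -/
noncomputable def subtree {V : Type*} [Fintype V] (p : V → V) (x : V) : Finset V :=
  Finset.univ.filter (IsBelow p x)

theorem mem_subtree {V : Type*} [Fintype V] {p : V → V} {x y : V} :
    y ∈ subtree p x ↔ IsBelow p x y := by
  simp [subtree]

/-- The vertices to which the edge from `a` to `b` starts a shortest path from `a`. -/
noncomputable def served {V : Type*} [Fintype V] (G : SimpleGraph V) (a b : V) : Finset V :=
  Finset.univ.filter fun y => G.dist a y = G.dist b y + 1

theorem mem_served {V : Type*} [Fintype V] {G : SimpleGraph V} {a b y : V} :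
    y ∈ served G a b ↔ G.dist a y = G.dist b y + 1 := by
  simp [served]

variable {V : Type*} [Fintype V] [DecidableEq V] {α : ℝ≥0} {s : Profile V} {r : V} {p : V → V}

theorem card_subtree_sdiff {b c : V} (hcb : p c = b) :
    (subtree p b \ subtree p c).card + (subtree p c).card = (subtree p b).card := by
  refine Finset.card_sdiff_add_card_eq_card fun y hy => ?_
  rw [mem_subtree] at hy ⊢
  exact IsBelow.trans ⟨1, hcb⟩ hy

/-- The equilibrium condition for replacing the edge to `b` by one to its neighbour `c`. -/
theorem card_le_card_of_swap (hs : IsNashEquilibrium α s) (hG : (graph s).Connected)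
    {v b c : V} (hb : b ∈ (s v).1) (hbc : (graph s).Adj b c) (hcv : c ≠ v) :
    (Finset.univ.filter fun y => (graph s).dist v y = (graph s).dist c y + 2).card ≤
      (Finset.univ.filter fun y => (graph s).dist v y = (graph s).dist b y + 1 ∧
        (graph s).dist v y ≠ (graph s).dist c y + 2).card := by
  have hbv : b ≠ v := fun h => (s v).2 (h ▸ hb)
  set f : V → ℕ := fun y => if (graph s).dist v y = (graph s).dist c y + 2 then
      (graph s).dist v y - 1 else if (graph s).dist v y = (graph s).dist b y + 1 then
      (graph s).dist v y + 1 else (graph s).dist v y with hf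
  have hdev := hs.deviate hG (v := v) (A := {b}) (B := {c}) (f := f) (by simpa using hb)
    (by simpa using hcv.symm) (by
    intro K hK hKc y
    have hK' : ∀ x y, (graph s).Adj x y → x ≠ v → y ≠ v → K.Adj x y := fun x y hxy h1 h2 =>
      hK x y hxy (fun h => h1 h.1) (fun h => h2 h.1)
    have hvc : K.edist v c ≤ (1 : ℕ) := by
      simpa using edist_le_one_of_adj (hKc c (by simp))
    have hcb : K.edist c b ≤ (1 : ℕ) := by
      simpa using edist_le_one_of_adj (hK' c b hbc.symm hcv hbv)
    simp only [hf]
    split_ifs with h1 h2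
    · refine (edist_le_add hvc (edist_le_dist_of_lt hG hK' (by omega))).trans ?_
      rw [Nat.cast_le]
      omega
    · refine (edist_le_add (edist_le_add hvc hcb)
        (edist_le_dist_of_lt hG hK' (by omega))).trans ?_
      rw [Nat.cast_le]
      omega
    · by_cases hy : v = y
      · subst hy
        simp
      obtain ⟨z, hvz, hz⟩ := exists_adj_dist_add_one hG hy
      have hzb : z ≠ b := by
        rintro rfl
        exact h2 hz.symm
      have h3 : K.edist v z ≤ (1 : ℕ) := by
        have : K.Adj v z := hK v z hvz (by simpa using hzb) (fun h => hvz.ne h.1.symm)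
        simpa using edist_le_one_of_adj this
      refine (edist_le_add h3 (edist_le_dist_of_lt hG hK' (by omega))).trans ?_
      rw [Nat.cast_le]
      omega)
  have h1 : ∑ y, (graph s).dist v y ≤ ∑ y, f y := by
    simp only [Finset.card_singleton, add_le_add_iff_left] at hdev
    exact_mod_cast hdev
  -- Gains are added on the left and losses on the right, which avoids truncated subtraction.
  have h2 : ∑ y, (f y + if (graph s).dist v y = (graph s).dist c y + 2 then 1 else 0) =
      ∑ y, ((graph s).dist v y + if (graph s).dist v y = (graph s).dist b y + 1 ∧
        (graph s).dist v y ≠ (graph s).dist c y + 2 then 1 else 0) := by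
    refine Finset.sum_congr rfl fun y _ => ?_
    simp only [hf]
    split_ifs <;> omega
  rw [Finset.sum_add_distrib, Finset.sum_add_distrib, ← Finset.card_filter,
    ← Finset.card_filter] at h2
  omega

section Passage

variable (hs : IsNashEquilibrium α s) (hG : (graph s).Connected)
  (hp : IsParentMap (graph s) r p) {b c : V} (hcb : p c = b) (hbr : b ≠ r) (hpbr : p b ≠ r)
  (hcr : c ≠ r) (hbuy : b ∈ (s (p b)).1)
  (hbridge : ∀ z, (graph s).Adj b z → z ≠ c → z ≠ p b → (graph s).IsBridge s(b, z))

include hG hp hcb hcr hbridge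

-- The parent of `b` may swap its edge to `b` for one to `c`. All of the subtree of `c` gains, and
-- only the part hanging at `b` loses; so that part is at least as large as the subtree of `c`.
include hs hbuy hpbr in
theorem card_served_le :
    (served (graph s) (p b) b).card + 2 * (subtree p c).card ≤ 2 * (subtree p b).card ∧
      2 * (subtree p c).card ≤ (subtree p b).card := by
  have hdb := hp.dist b
  have hdc := hp.dist c
  rw [hcb] at hdc
  have hpos := IsParentMap.dist_pos hG hpbr
  have hposc := IsParentMap.dist_pos hG hcr
  have hbc : (graph s).Adj b c := by
    have := hp.adj c hcr
    rw [hcb] at this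
    exact this.symm
  have h1 := card_le_card_of_swap hs hG hbuy hbc (by rintro rfl; omega)
  have h2 : (Finset.univ.filter fun y => (graph s).dist (p b) y = (graph s).dist b y + 1 ∧
      (graph s).dist (p b) y ≠ (graph s).dist c y + 2) ⊆ subtree p b \ subtree p c := by
    intro y hy
    rw [Finset.mem_filter] at hy
    rw [Finset.mem_sdiff, mem_subtree, mem_subtree]
    by_contra hy'
    rcases hp.dist_eq_of_not_hanging hG hcb hcr hbridge hy' with h | h <;> omega
  have h3 : subtree p c ⊆
      Finset.univ.filter fun y => (graph s).dist (p b) y = (graph s).dist c y + 2 := by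
    intro y hy
    rw [mem_subtree] at hy
    have h4 := hp.dist_of_isBelow hG hy
    have h5 := hp.dist_of_isBelow hG (IsBelow.trans (⟨2, by simp [hcb]⟩ : IsBelow p (p b) c) hy)
    have h6 := hp.dist_le_of_isBelow hy
    rw [Finset.mem_filter]
    exact ⟨Finset.mem_univ y, by omega⟩
  have h7 : served (graph s) (p b) b ⊆
      (Finset.univ.filter fun y => (graph s).dist (p b) y = (graph s).dist c y + 2) ∪
      (Finset.univ.filter fun y => (graph s).dist (p b) y = (graph s).dist b y + 1 ∧
        (graph s).dist (p b) y ≠ (graph s).dist c y + 2) := by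
    intro y hy
    rw [mem_served] at hy
    simp only [Finset.mem_union, Finset.mem_filter, Finset.mem_univ, true_and]
    tauto
  have h8 := Finset.card_le_card h2
  have h9 := Finset.card_le_card h3
  have h10 := (Finset.card_le_card h7).trans (Finset.card_union_le _ _)
  have h11 := card_subtree_sdiff (p := p) hcb
  omega

-- Climbing from `b` to its parent brings each vertex one step closer, except those served by one of
-- the two chain edges at `b`.
include hbr in
theorem sum_dist_parent_le :
    ∑ y, (graph s).dist (p b) y + Fintype.card V ≤ ∑ y, (graph s).dist b y +
      2 * (served (graph s) (p b) b).card + (served (graph s) b c).card := by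
  have hadj := hp.adj b hbr
  have h : ∑ y, ((graph s).dist (p b) y + 1) ≤ ∑ y, ((graph s).dist b y +
      2 * (if y ∈ served (graph s) (p b) b then 1 else 0) +
      if y ∈ served (graph s) b c then 1 else 0) := by
    refine Finset.sum_le_sum fun y _ => ?_
    simp only [mem_served]
    have h1 := dist_le_dist_add_one hG hadj y
    have h2 := dist_le_dist_add_one hG hadj.symm y
    by_cases hy : IsBelow p b y ∧ ¬IsBelow p c y
    · have hb' : ¬(IsBelow p b (p b) ∧ ¬IsBelow p c (p b)) := by
        rintro ⟨h3, -⟩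
        have h4 := hp.dist_le_of_isBelow h3
        have h5 := hp.dist b
        have h6 := IsParentMap.dist_pos hG hbr
        omega
      have := hp.dist_eq_add_one_of_hanging hG hcb hcr hbridge hy.1 hy.2 hadj hb'
      rw [if_pos this]
      omega
    · rcases hp.dist_eq_of_not_hanging hG hcb hcr hbridge hy with h3 | h3
      · rw [if_pos h3]
        split_ifs <;> omega
      · omega
  simp only [Finset.sum_add_distrib, ← Finset.mul_sum, Finset.sum_boole,
    Finset.filter_univ_mem, Finset.sum_const, Finset.card_univ, smul_eq_mul, mul_one,
    Nat.cast_id] at h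
  exact h

end Passage

section Chains

variable (hs : IsNashEquilibrium α s) (hG : (graph s).Connected)
  (hα : 65 * (Fintype.card V : ℝ) ≤ α) (hp : IsParentMap (graph s) r p)
  (hr : ∀ v, ∑ y, (graph s).dist r y ≤ ∑ y, (graph s).dist v y)

include hs hG hα hp hr

/-- The vertex may trade its chain edge downwards for an edge to `r`. Only the subtree cut off takes
the detour over the chord. -/
theorem BuysChord.sum_dist_le {u w : V} (h : BuysChord s p u w) {a : ℕ} (ha : a + 1 ≤ 21) :
    ∑ y, (graph s).dist (p^[a + 1] u) y ≤ ∑ y, (graph s).dist r y + Fintype.card V +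
      2 * (a + 1) * (subtree p (p^[a] u)).card := by
  have hroot := h.iterate_ne_root hs hG hα hp ha
  have hdev := hs.deviate hG (v := p^[a + 1] u) (A := {p^[a] u}) (B := {r})
    (f := fun y => (graph s).dist r y + 1 +
      2 * (a + 1) * if y ∈ subtree p (p^[a] u) then 1 else 0)
    (by simpa using h.mem_iterate hs hG hα hp hr ha) (by simpa using hroot) (by
    intro K hK hKr y
    have hK' : ∀ x y, (graph s).Adj x y → x ≠ p^[a + 1] u → y ≠ p^[a + 1] u → K.Adj x y :=
      fun x y hxy h1 h2 => hK x y hxy (fun h => h1 h.1) (fun h => h2 h.1)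
    have hvr : K.Adj (p^[a + 1] u) r := hKr r (by simp)
    by_cases hy : IsBelow p (p^[a] u) y
    · simp only [if_pos (mem_subtree.2 hy), mul_one]
      exact h.edist_le hs hG hα hp ha hK' hvr hy
    simp only [if_neg (mt mem_subtree.1 hy), mul_zero, add_zero]
    by_cases hvy : IsBelow p (p^[a + 1] u) y
    · have h3 := hp.edist_le_of_isBelow hG (K := K) hvy (fun x hx hdx hadj => hK _ _ hadj (by
        rintro ⟨rfl, -⟩
        omega) (by
        rintro ⟨-, h4⟩
        rw [Finset.mem_singleton.1 h4] at hx
        exact hy hx))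
      rw [SimpleGraph.edist_comm]
      refine h3.trans ?_
      rw [Nat.cast_le]
      omega
    · have h1 := hp.edist_root_le hG hK' hvy
      rw [SimpleGraph.edist_comm] at h1
      have h2 : K.edist (p^[a + 1] u) r ≤ (1 : ℕ) := by simpa using edist_le_one_of_adj hvr
      refine (edist_le_add h2 h1).trans ?_
      rw [Nat.cast_le]
      omega)
  simp only [Finset.card_singleton, add_le_add_iff_left, Nat.cast_le, Finset.sum_add_distrib,
    ← Finset.mul_sum, Finset.sum_boole, Finset.filter_univ_mem, Finset.sum_const,
    Finset.card_univ, smul_eq_mul, mul_one, Nat.cast_id] at hdev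
  exact hdev

/-- Among ten consecutive vertices close above a chord, one lies on an edge, other than those to
its two neighbours on the way, that is not a bridge. -/
theorem BuysChord.exists_not_isBridge {u w : V} (h : BuysChord s p u w) {c : ℕ} (hc : c ≤ 10) :
    ∃ i, c + 1 ≤ i + 1 ∧ i + 1 ≤ c + 10 ∧ ∃ z, (graph s).Adj (p^[i + 1] u) z ∧ z ≠ p^[i] u ∧
      z ≠ p^[i + 2] u ∧ ¬(graph s).IsBridge s(p^[i + 1] u, z) := by
  by_contra! hno
  set m : ℕ → ℕ := fun i => (subtree p (p^[i] u)).card with hm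
  set Y : ℕ → ℕ := fun i => (served (graph s) (p^[i + 1] u) (p^[i] u)).card with hY
  set D : ℕ → ℕ := fun i => ∑ y, (graph s).dist (p^[i] u) y with hD
  have hit : ∀ i, p (p^[i] u) = p^[i + 1] u := fun i => (Function.iterate_succ_apply' p i u).symm
  have hbr : ∀ i, c ≤ i → i < c + 10 → ∀ z, (graph s).Adj (p^[i + 1] u) z → z ≠ p^[i] u →
      z ≠ p (p^[i + 1] u) → (graph s).IsBridge s(p^[i + 1] u, z) := by
    intro i h1 h2 z h3 h4 h5
    rw [hit] at h5
    exact hno i (by omega) (by omega) z h3 h4 h5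
  have hroot : ∀ i, i ≤ 21 → p^[i] u ≠ r := fun i hi => h.iterate_ne_root hs hG hα hp hi
  have h1 : ∀ i, c ≤ i → i < c + 10 → Y (i + 1) + 2 * m i ≤ 2 * m (i + 1) ∧
      2 * m i ≤ m (i + 1) := by
    intro i h1 h2
    have := card_served_le hs hG hp (hit i)
      (by rw [hit]; exact hroot (i + 2) (by omega)) (hroot i (by omega))
      (by rw [hit]; exact h.mem_iterate hs hG hα hp hr (by omega)) (hbr i h1 h2)
    rwa [hit] at this
  have h2 : ∀ i, c ≤ i → i < c + 10 →
      D (i + 2) + Fintype.card V ≤ D (i + 1) + 2 * Y (i + 1) + Y i := by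
    intro i h1 h2
    have := sum_dist_parent_le hG hp (hit i) (hroot (i + 1) (by omega)) (hroot i (by omega))
      (hbr i h1 h2)
    rwa [hit] at this
  have h3 : D (c + 2) ≤ ∑ y, (graph s).dist r y + Fintype.card V + 2 * (c + 2) * m (c + 1) :=
    h.sum_dist_le hs hG hα hp hr (a := c + 1) (by omega)
  have h4 : ∑ y, (graph s).dist r y ≤ D (c + 11) := hr _
  have h5 : m (c + 10) ≤ Fintype.card V := Finset.card_le_univ _
  have h6 : 2 * (c + 2) * m (c + 1) ≤ 24 * m (c + 1) := Nat.mul_le_mul_right _ (by omega)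
  have hpos : 0 < Fintype.card V := Fintype.card_pos_iff.2 ⟨u⟩
  -- Telescoping gives `8 n ≤ 4 m (c + 10) + 2 m (c + 9) + 20 m (c + 1)`. By doubling, `m (c + 9) ≤
  -- n / 2` and `m (c + 1) ≤ n / 512`, so the right side is below `6 n`.
  have g0 := h1 c (by omega) (by omega)
  have g1 := h1 (c + 1) (by omega) (by omega)
  have g2 := h1 (c + 2) (by omega) (by omega)
  have g3 := h1 (c + 3) (by omega) (by omega)
  have g4 := h1 (c + 4) (by omega) (by omega)
  have g5 := h1 (c + 5) (by omega) (by omega)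
  have g6 := h1 (c + 6) (by omega) (by omega)
  have g7 := h1 (c + 7) (by omega) (by omega)
  have g8 := h1 (c + 8) (by omega) (by omega)
  have g9 := h1 (c + 9) (by omega) (by omega)
  have d1 := h2 (c + 1) (by omega) (by omega)
  have d2 := h2 (c + 2) (by omega) (by omega)
  have d3 := h2 (c + 3) (by omega) (by omega)
  have d4 := h2 (c + 4) (by omega) (by omega)
  have d5 := h2 (c + 5) (by omega) (by omega)
  have d6 := h2 (c + 6) (by omega) (by omega)
  have d7 := h2 (c + 7) (by omega) (by omega)
  have d8 := h2 (c + 8) (by omega) (by omega)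
  have d9 := h2 (c + 9) (by omega) (by omega)
  clear_value m Y D
  simp only [add_assoc, Nat.reduceAdd] at g1 g2 g3 g4 g5 g6 g7 g8 g9 d1 d2 d3 d4 d5 d6 d7 d8 d9
  omega

end Chains

end NetworkCreation

/-! ### Counting non-bridge edges -/

namespace NetworkCreation

section CyclePart

variable {V : Type*} {G : SimpleGraph V}

/-- The graph formed by the edges of `G` that are not bridges. -/
def cyclePart (G : SimpleGraph V) : SimpleGraph V where
  Adj a b := G.Adj a b ∧ ¬G.IsBridge s(a, b)
  symm := ⟨fun a b h => ⟨h.1.symm, by rw [Sym2.eq_swap]; exact h.2⟩⟩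
  loopless := ⟨fun _ h => h.1.ne rfl⟩

/-- A non-bridge lies on a cycle, whose other edge at `v` is not a bridge either. -/
theorem exists_ne_adj_cyclePart {v w : V} (h : (cyclePart G).Adj v w) :
    ∃ z, z ≠ w ∧ (cyclePart G).Adj v z := by
  classical
  obtain ⟨hvw, hb⟩ := h
  rw [SimpleGraph.isBridge_iff, not_not] at hb
  obtain ⟨q, hq⟩ := hb.exists_isPath
  cases q with
  | nil => exact absurd rfl hvw.ne
  | @cons _ z _ hvz q =>
    rw [SimpleGraph.Walk.cons_isPath_iff] at hq
    rw [SimpleGraph.deleteEdges_adj] at hvz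
    have hzw : z ≠ w := by
      rintro rfl
      exact hvz.2 rfl
    refine ⟨z, hzw, hvz.1, ?_⟩
    rw [SimpleGraph.isBridge_iff_forall_walk_mem_edges]
    intro hall
    let q' := q.mapLe (SimpleGraph.deleteEdges_le (G := G) {s(v, w)})
    have h1 := hall (q'.concat hvw.symm).reverse
    rw [SimpleGraph.Walk.edges_reverse, List.mem_reverse, SimpleGraph.Walk.edges_concat,
      List.concat_eq_append, List.mem_append, List.mem_singleton] at h1
    rcases h1 with h1 | h1
    · have h2 := q'.fst_mem_support_of_mem_edges h1
      rw [SimpleGraph.Walk.support_mapLe_eq_support] at h2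
      exact hq.2 h2
    · rw [Sym2.eq_iff] at h1
      rcases h1 with h1 | h1
      · exact hvw.ne h1.1
      · exact hzw h1.2

end CyclePart

variable {V : Type*} [Fintype V] [DecidableEq V] {α : ℝ≥0} {s : Profile V} {r : V} {p : V → V}

omit [Fintype V] [DecidableEq V] in
theorem buysChord_or_buysChord {a b : V} (hab : (graph s).Adj a b) (h1 : p a ≠ b)
    (h2 : p b ≠ a) : BuysChord s p a b ∨ BuysChord s p b a :=
  hab.imp (fun h => ⟨h, h1, h2⟩) (fun h => ⟨h, h2, h1⟩)

section Counting

variable (hs : IsNashEquilibrium α s) (hG : (graph s).Connected)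
  (hα : 65 * (Fintype.card V : ℝ) ≤ α) (hp : IsParentMap (graph s) r p)
  (hr : ∀ v, ∑ y, (graph s).dist r y ≤ ∑ y, (graph s).dist v y)

include hs hG hα hp hr

open Classical in
theorem BuysChord.exists_three_le_degree {u w : V} (h : BuysChord s p u w) {c : ℕ}
    (hc : c ≤ 10) :
    ∃ i, c + 1 ≤ i ∧ i ≤ c + 10 ∧ 3 ≤ (cyclePart (graph s)).degree (p^[i] u) := by
  obtain ⟨i, h1, h2, z, hz, hz1, hz2, hzb⟩ := h.exists_not_isBridge hs hG hα hp hr hc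
  refine ⟨i + 1, h1, h2, ?_⟩
  have hd := hp.dist_iterate i u
  have hd2 := hp.dist_iterate (i + 2) u
  have hdu := h.lt_dist hs hG hα hp
  have hne : p^[i] u ≠ p^[i + 2] u := by
    intro h3
    rw [h3] at hd
    omega
  have hb0 := h.not_isBridge hs hG hα hp (i := i) (by omega)
  have hb1 := h.not_isBridge hs hG hα hp (i := i + 1) (by omega)
  have ha0 := hp.adj _ (h.iterate_ne_root hs hG hα hp (i := i) (by omega))
  have ha1 := hp.adj _ (h.iterate_ne_root hs hG hα hp (i := i + 1) (by omega))
  rw [← Function.iterate_succ_apply' p] at ha0 ha1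
  rw [Sym2.eq_swap] at hb0
  rw [← Finset.card_eq_three.2 ⟨z, p^[i] u, p^[i + 2] u, hz1, hz2, hne, rfl⟩,
    ← SimpleGraph.card_neighborFinset_eq_degree]
  refine Finset.card_le_card fun y hy => ?_
  rw [SimpleGraph.mem_neighborFinset]
  simp only [Finset.mem_insert, Finset.mem_singleton] at hy
  rcases hy with rfl | rfl | rfl
  · exact ⟨hz, hzb⟩
  · exact ⟨ha0.symm, hb0⟩
  · exact ⟨ha1, hb1⟩

open Classical in
theorem two_mul_card_chord_owners_le :
    2 * (Finset.univ.filter fun u => ∃ w, BuysChord s p u w).card ≤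
      (Finset.univ.filter fun v => 3 ≤ (cyclePart (graph s)).degree v).card := by
  have hex : ∀ x : V × ℕ, ∃ i, ((∃ w, BuysChord s p x.1 w) ∧ x.2 ≤ 10) →
      x.2 + 1 ≤ i ∧ i ≤ x.2 + 10 ∧ 3 ≤ (cyclePart (graph s)).degree (p^[i] x.1) := by
    intro x
    by_cases hx : (∃ w, BuysChord s p x.1 w) ∧ x.2 ≤ 10
    · obtain ⟨⟨w, hw⟩, hc⟩ := hx
      obtain ⟨i, hi⟩ := hw.exists_three_le_degree hs hG hα hp hr hc
      exact ⟨i, fun _ => hi⟩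
    · exact ⟨0, fun h => absurd h hx⟩
  choose i hi using hex
  set U := Finset.univ.filter fun u => ∃ w, BuysChord s p u w with hU
  -- The starts 0 and 10 give disjoint windows of indices, 1 to 10 and 11 to 20, within each chain.
  have hcard : (U ×ˢ ({0, 10} : Finset ℕ)).card = 2 * U.card := by
    rw [Finset.card_product, Finset.card_pair (by norm_num), mul_comm]
  have hmem : ∀ x ∈ U ×ˢ ({0, 10} : Finset ℕ),
      (∃ w, BuysChord s p x.1 w) ∧ (x.2 = 0 ∨ x.2 = 10) := by
    intro x hx
    simpa [hU] using hx
  rw [← hcard]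
  refine Finset.card_le_card_of_injOn (fun x => p^[i x] x.1) ?_ ?_
  · intro x hx
    obtain ⟨h1, h2⟩ := hmem x hx
    simpa using (hi x ⟨h1, by omega⟩).2.2
  · intro x hx y hy hxy
    obtain ⟨⟨w, h1⟩, h2⟩ := hmem x hx
    obtain ⟨⟨w', h3⟩, h4⟩ := hmem y hy
    have h5 := hi x ⟨⟨w, h1⟩, by omega⟩
    have h6 := hi y ⟨⟨w', h3⟩, by omega⟩
    simp only at hxy
    have h7 := h1.eq_of_iterate_eq hs hG hα hp hr h3 (by omega) (by omega) hxy
    -- The owner has depth above 21, so depth determines the index in the chain and hence the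
    -- window.
    have h8 := h1.lt_dist hs hG hα hp
    have h9 := hp.dist_iterate (i x) x.1
    rw [hxy, hp.dist_iterate, ← h7] at h9
    exact Prod.ext h7 (by omega)

-- Each owner buys a single chord. Tree edges of the cycle part are charged to their lower ends, and
-- the non-isolated vertex nearest the root is never charged, which makes the inequality strict.
open Classical in
theorem card_edgeFinset_cyclePart_lt (hne : ∃ a b, (cyclePart (graph s)).Adj a b) :
    (cyclePart (graph s)).edgeFinset.card <
      (Finset.univ.filter fun u => ∃ w, BuysChord s p u w).card +
      (Finset.univ.filter fun v => ∃ w, (cyclePart (graph s)).Adj v w).card := by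
  set H := cyclePart (graph s)
  set W := Finset.univ.filter fun v => ∃ w, H.Adj v w with hW
  set U := Finset.univ.filter fun u => ∃ w, BuysChord s p u w with hU
  have hWne : W.Nonempty := by
    obtain ⟨a, b, hab⟩ := hne
    exact ⟨a, by simpa [hW] using ⟨b, hab⟩⟩
  obtain ⟨m, hmW, hm⟩ := W.exists_min_image ((graph s).dist r) hWne
  have hex : ∀ u, ∃ w, (∃ w, BuysChord s p u w) → BuysChord s p u w := by
    intro u
    by_cases hu : ∃ w, BuysChord s p u w
    · exact ⟨hu.choose, fun _ => hu.choose_spec⟩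
    · exact ⟨u, fun h => absurd h hu⟩
  choose g hg using hex
  have hchord : ∀ a b, BuysChord s p a b → s(a, b) ∈ U.image fun u => s(u, g u) := by
    intro a b hab
    refine Finset.mem_image.2 ⟨a, by simpa [hU] using ⟨b, hab⟩, ?_⟩
    rw [hab.unique hs hG hα hp hr (hg a ⟨b, hab⟩)]
  have htree : ∀ a, H.Adj a (p a) → s(a, p a) ∈ (W.erase m).image fun v => s(v, p v) := by
    intro a ha
    refine Finset.mem_image.2 ⟨a, Finset.mem_erase.2 ⟨?_, by simpa [hW] using ⟨_, ha⟩⟩, rfl⟩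
    rintro rfl
    have har : a ≠ r := by
      rintro rfl
      rw [hp.root] at ha
      exact ha.ne rfl
    have h1 := hm (p a) (by simpa [hW] using ⟨_, ha.symm⟩)
    have h2 := hp.dist a
    have h3 := IsParentMap.dist_pos hG har
    omega
  have hsub : H.edgeFinset ⊆ (U.image fun u => s(u, g u)) ∪
      (W.erase m).image fun v => s(v, p v) := by
    intro e he
    induction e with
    | h a b =>
      rw [SimpleGraph.mem_edgeFinset, SimpleGraph.mem_edgeSet] at he
      rw [Finset.mem_union]
      by_cases h1 : p a = b
      · subst h1
        exact Or.inr (htree a he)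
      by_cases h2 : p b = a
      · subst h2
        rw [Sym2.eq_swap]
        exact Or.inr (htree b he.symm)
      left
      rcases buysChord_or_buysChord he.1 h1 h2 with h3 | h3
      · exact hchord a b h3
      · rw [Sym2.eq_swap]
        exact hchord b a h3
  have h1 := (Finset.card_le_card hsub).trans (Finset.card_union_le _ _)
  have h2 : (U.image fun u => s(u, g u)).card ≤ U.card := Finset.card_image_le
  have h3 : ((W.erase m).image fun v => s(v, p v)).card ≤ (W.erase m).card :=
    Finset.card_image_le
  have h4 := Finset.card_erase_add_one hmW
  omega

end Counting

theorem IsNashEquilibrium.isTree [Nonempty V] (hs : IsNashEquilibrium α s)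
    (hα : 65 * (Fintype.card V : ℝ) ≤ α) : (graph s).IsTree := by
  classical
  have hG := hs.connected
  refine ⟨hG, ?_⟩
  by_contra hcyc
  obtain ⟨r, -, hr⟩ := (Finset.univ : Finset V).exists_min_image
    (fun v => ∑ y, (graph s).dist v y) Finset.univ_nonempty
  replace hr : ∀ v, ∑ y, (graph s).dist r y ≤ ∑ y, (graph s).dist v y :=
    fun v => hr v (Finset.mem_univ v)
  obtain ⟨p, hp⟩ := exists_isParentMap hG r
  have hne : ∃ a b, (cyclePart (graph s)).Adj a b := by
    rw [SimpleGraph.isAcyclic_iff_forall_adj_isBridge] at hcyc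
    push Not at hcyc
    exact hcyc
  have h1 := card_edgeFinset_cyclePart_lt hs hG hα hp hr hne
  have h2 := two_mul_card_chord_owners_le hs hG hα hp hr
  have h3 := (cyclePart (graph s)).sum_degrees_eq_twice_card_edges
  -- Lower bound for the degree sum: 2 per non-isolated vertex, and 1 more per vertex of degree at
  -- least 3.
  have h4 : ∑ v, (2 * (if ∃ w, (cyclePart (graph s)).Adj v w then 1 else 0) +
      if 3 ≤ (cyclePart (graph s)).degree v then 1 else 0) ≤
      ∑ v, (cyclePart (graph s)).degree v := by
    refine Finset.sum_le_sum fun v _ => ?_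
    have h5 : (∃ w, (cyclePart (graph s)).Adj v w) → 2 ≤ (cyclePart (graph s)).degree v := by
      rintro ⟨w, hw⟩
      obtain ⟨z, hzw, hz⟩ := exists_ne_adj_cyclePart hw
      rw [← SimpleGraph.card_neighborFinset_eq_degree, ← Finset.card_pair hzw]
      refine Finset.card_le_card fun y hy => ?_
      rw [SimpleGraph.mem_neighborFinset]
      simp only [Finset.mem_insert, Finset.mem_singleton] at hy
      rcases hy with rfl | rfl
      · exact hz
      · exact hw
    split_ifs with h6 <;> first | omega | (have := h5 h6; omega)
  simp only [Finset.sum_add_distrib, ← Finset.mul_sum, Finset.sum_boole, Nat.cast_id] at h4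
  omega

end NetworkCreation

theorem mainTheorem1 (n : ℕ) (hn : 1 ≤ n) (α : ℝ≥0) (hα : 65 * (n : ℝ≥0) ≤ α)
    (G : SimpleGraph (Fin n)) (hG : NetworkCreation.IsNashGraph α G) :
    G.IsTree := by
  obtain ⟨s, hs, rfl⟩ := hG
  have : Nonempty (Fin n) := ⟨⟨0, hn⟩⟩
  refine hs.isTree ?_
  rw [Fintype.card_fin]
  exact_mod_cast hα
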